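/- Let $n\ge 1$, $s\ge 1$, and let $M$ be a non-empty smooth manifold of dimension $2n+s$ with a Riemannian metric $g$, Levi-Civita connection $\nabla$ and curvature tensor $R_{X,Y}=\nabla_X\nabla_Y-\nabla_Y\nabla_X-\nabla_{[X,Y]}$. Let $(f,Q,\xi_i,\eta^i,g)$, $1\le i\le s$, be a weak almost $\mathcal S$-structure on $M$: $f$ is a smooth $(1,1)$-tensor of rank $2n$, $Q$ is a smooth non-singular $(1,1)$-tensor, $\xi_i$ are smooth vector fields and $\eta^i$ smooth 1-forms such that, for all vector fields $X,Y$, $$f^2=-Q+\sum_i\eta^i\otimes\xi_i,\qquad \eta^i(\xi_j)=\delta^i_j,\qquad Q\,\xi_i=\xi_i,$$ $$g(fX,fY)=g(X,QY)-\sum_i\eta^i(X)\,\eta^i(Y),$$ $$g(X,fY)=d\eta^i(X,Y)\quad (1\le i\le s),$$ where $d\eta^i(X,Y)=\frac12\{X(\eta^i(Y))-Y(\eta^i(X))-\eta^i([X,Y])\}$. Suppose that (a) $\pounds_{\xi_i}Q=0$ for $1\le i\le s$, that is, $[\xi_i,QX]=Q[\xi_i,X]$ for all vector fields $X$; and (b)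 $(\nabla_XQ)Y=0$ for all vector fields $X,Y$ tangent to the distribution $\mathcal D=\bigcap_i\ker\eta^i$, where $(\nabla_XQ)Y=\nabla_X(QY)-Q\nabla_XY$. If $M$ is flat, that is, if $R=0$ on $M$, then $n\le 1$. In other words, there is no flat weak almost $\mathcal S$-manifold $M^{2n+s}$ with $n>1$ satisfying (a) and (b). -/

import Mathlib

open Bundle
open scoped Manifold ContDiff

noncomputable section

namespace WeakAlmostS

/-! ### The Levi-Civita connection and the curvature tensor of a Riemannian manifold -/

section Riemannian

variable {E : Type*} [NormedAddCommGroup E] [NormedSpace ℝ E]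
  {H : Type*} [TopologicalSpace H] (I : ModelWithCorners ℝ E H)
  {M : Type*} [TopologicalSpace M] [ChartedSpace H M]

/-- `X` is a smooth (that is, `C^∞`) vector field on `M`. -/
def SmoothVF [IsManifold I ∞ M] (X : Π x : M, TangentSpace I x) : Prop :=
  ContMDiff I I.tangent ∞ (fun x ↦ (⟨x, X x⟩ : TangentBundle I M))

/-- The derivative `X(φ)` at `x` of a real function `φ` in the direction of a vector field `X`. -/
def dirDeriv (X : Π x : M, TangentSpace I x) (φ : M → ℝ) (x : M) : ℝ :=
  mvfderiv I φ x (X x)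

variable {I} in
lemma dirDeriv_add {X : Π x : M, TangentSpace I x} {φ ψ : M → ℝ} {x : M}
    (hφ : MDiffAt φ x) (hψ : MDiffAt ψ x) :
    dirDeriv I X (φ + ψ) x = dirDeriv I X φ x + dirDeriv I X ψ x := by
  simp [dirDeriv, mvfderiv_add hφ hψ]

variable {I} in
lemma dirDeriv_mul {X : Π x : M, TangentSpace I x} {φ ψ : M → ℝ} {x : M}
    (hφ : MDiffAt φ x) (hψ : MDiffAt ψ x) :
    dirDeriv I X (φ * ψ) x = φ x * dirDeriv I X ψ x + dirDeriv I X φ x * ψ x := by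
  simp [dirDeriv, mvfderiv_mul hφ hψ]
  ring

variable {I} in
lemma dirDeriv_add_left (X X' : Π x : M, TangentSpace I x) (φ : M → ℝ) (x : M) :
    dirDeriv I (X + X') φ x = dirDeriv I X φ x + dirDeriv I X' φ x := by
  simp [dirDeriv]

variable {I} in
lemma dirDeriv_smul_left (ψ : M → ℝ) (X : Π x : M, TangentSpace I x) (φ : M → ℝ) (x : M) :
    dirDeriv I (ψ • X) φ x = ψ x * dirDeriv I X φ x := by
  simp [dirDeriv]

variable [RiemannianBundle (fun x : M ↦ TangentSpace I x)]

/-- The function `g(X, Y)`. -/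
def metric (X Y : Π x : M, TangentSpace I x) (x : M) : ℝ := inner ℝ (X x) (Y x)

/-- Half of the right-hand side of the Koszul formula, which is to be `g(∇_X Y, Z)` at `x`. -/
def koszul (X Y Z : Π x : M, TangentSpace I x) (x : M) : ℝ :=
  (dirDeriv I X (metric I Y Z) x + dirDeriv I Y (metric I Z X) x - dirDeriv I Z (metric I X Y) x
    + metric I (VectorField.mlieBracket I X Y) Z x
    - metric I (VectorField.mlieBracket I Y Z) X x
    + metric I (VectorField.mlieBracket I Z X) Y x) / 2

variable {I}

lemma metric_comm (X Y : Π x : M, TangentSpace I x) : metric I X Y = metric I Y X :=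
  funext fun _ ↦ real_inner_comm _ _

lemma metric_add_left (X X' Y : Π x : M, TangentSpace I x) :
    metric I (X + X') Y = metric I X Y + metric I X' Y :=
  funext fun _ ↦ inner_add_left _ _ _

lemma metric_smul_left (φ : M → ℝ) (X Y : Π x : M, TangentSpace I x) :
    metric I (φ • X) Y = φ * metric I X Y :=
  funext fun _ ↦ real_inner_smul_left _ _ _

lemma metric_add_right (X Y Y' : Π x : M, TangentSpace I x) :
    metric I X (Y + Y') = metric I X Y + metric I X Y' :=
  funext fun _ ↦ inner_add_right _ _ _

lemma metric_smul_right (φ : M → ℝ) (X Y : Π x : M, TangentSpace I x) :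
    metric I X (φ • Y) = φ * metric I X Y :=
  funext fun _ ↦ real_inner_smul_right _ _ _

variable [IsManifold I ∞ M]
  [IsContMDiffRiemannianBundle I ∞ E (fun x : M ↦ TangentSpace I x)]

lemma metric_mdiffAt {X Y : Π x : M, TangentSpace I x} {x : M}
    (hX : MDiffAt (T% X) x) (hY : MDiffAt (T% Y) x) : MDiffAt (metric I X Y) x :=
  MDifferentiableAt.inner_bundle (E := fun x : M ↦ TangentSpace I x) (F := E) (b := id) hX hY

variable [FiniteDimensional ℝ E]

lemma koszul_tensorial₁ {Y Z : Π x : M, TangentSpace I x} {x : M}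
    (hY : MDiffAt (T% Y) x) (hZ : MDiffAt (T% Z) x) :
    TensorialAt I E (fun X ↦ koszul I X Y Z x) x where
  smul {φ X} hφ hX := by
    have := FiniteDimensional.complete ℝ E
    have e1 := VectorField.mlieBracket_smul_left (W := Y) hφ hX
    have e2 := VectorField.mlieBracket_smul_right (V := Z) hφ hX
    simp only [koszul, metric_smul_left, metric_smul_right, dirDeriv_smul_left,
      dirDeriv_mul hφ (metric_mdiffAt hZ hX), dirDeriv_mul hφ (metric_mdiffAt hX hY)]
    simp only [metric, e1, e2, dirDeriv, inner_add_left, real_inner_smul_left, inner_neg_left,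
      Pi.mul_apply, neg_smul, real_inner_comm (Z x) (X x)]
    ring
  add {X X'} hX hX' := by
    have := FiniteDimensional.complete ℝ E
    have e1 := VectorField.mlieBracket_add_left (W := Y) hX hX'
    have e2 := VectorField.mlieBracket_add_right (V := Z) hX hX'
    simp only [koszul, metric_add_left, metric_add_right, dirDeriv_add_left,
      dirDeriv_add (metric_mdiffAt hZ hX) (metric_mdiffAt hZ hX'),
      dirDeriv_add (metric_mdiffAt hX hY) (metric_mdiffAt hX' hY)]
    simp only [metric, e1, e2, inner_add_left, Pi.add_apply]
    ring

lemma koszul_tensorial₃ {X Y : Π x : M, TangentSpace I x} {x : M}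
    (hX : MDiffAt (T% X) x) (hY : MDiffAt (T% Y) x) :
    TensorialAt I E (fun Z ↦ koszul I X Y Z x) x where
  smul {φ Z} hφ hZ := by
    have := FiniteDimensional.complete ℝ E
    have e1 := VectorField.mlieBracket_smul_left (W := X) hφ hZ
    have e2 := VectorField.mlieBracket_smul_right (V := Y) hφ hZ
    simp only [koszul, metric_smul_left, metric_smul_right, dirDeriv_smul_left,
      dirDeriv_mul hφ (metric_mdiffAt hY hZ), dirDeriv_mul hφ (metric_mdiffAt hZ hX)]
    simp only [metric, e1, e2, dirDeriv, inner_add_left, real_inner_smul_left, inner_neg_left,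
      Pi.mul_apply, neg_smul, real_inner_comm (Z x) (Y x)]
    ring
  add {Z Z'} hZ hZ' := by
    have := FiniteDimensional.complete ℝ E
    have e1 := VectorField.mlieBracket_add_left (W := X) hZ hZ'
    have e2 := VectorField.mlieBracket_add_right (V := Y) hZ hZ'
    simp only [koszul, metric_add_left, metric_add_right, dirDeriv_add_left,
      dirDeriv_add (metric_mdiffAt hY hZ) (metric_mdiffAt hY hZ'),
      dirDeriv_add (metric_mdiffAt hZ hX) (metric_mdiffAt hZ' hX)]
    simp only [metric, e1, e2, inner_add_left, Pi.add_apply]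
    ring

variable (I) in
/-- The bilinear form `(u, w) ↦ g(∇_u Y, w)` on the tangent space at `x`, given by the Koszul
formula, for a vector field `Y` that is differentiable at `x`. -/
def koszulForm (Y : Π x : M, TangentSpace I x) (x : M) (hY : MDiffAt (T% Y) x) :
    TangentSpace I x →L[ℝ] TangentSpace I x →L[ℝ] ℝ :=
  TensorialAt.mkHom₂ (I := I) (F := E) (F' := E) (V := fun x : M ↦ TangentSpace I x)
    (V' := fun x : M ↦ TangentSpace I x) (fun X Z ↦ koszul I X Y Z x) x
    (fun _ hZ ↦ koszul_tensorial₁ hY hZ) (fun _ hX ↦ koszul_tensorial₃ hX hY)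

lemma koszulForm_apply {X Y Z : Π x : M, TangentSpace I x} {x : M}
    (hX : MDiffAt (T% X) x) (hY : MDiffAt (T% Y) x) (hZ : MDiffAt (T% Z) x) :
    koszulForm I Y x hY (X x) (Z x) = koszul I X Y Z x :=
  TensorialAt.mkHom₂_apply (I := I) (F := E) (F' := E) (V := fun x : M ↦ TangentSpace I x)
    (V' := fun x : M ↦ TangentSpace I x) _ _ hX hZ

instance completeSpace_tangentSpace (x : M) : CompleteSpace (TangentSpace I x) :=
  have : FiniteDimensional ℝ (TangentSpace I x) := inferInstanceAs (FiniteDimensional ℝ E)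
  FiniteDimensional.complete ℝ (TangentSpace I x)

open Classical in
variable (I) in
/-- The value `∇Y` at `x` of the Levi-Civita connection: the vector `∇_u Y` is determined by the
Koszul formula for `g(∇_u Y, w)`. Where `Y` is not differentiable, the value is set to be zero. -/
def leviCivitaFun (Y : Π x : M, TangentSpace I x) (x : M) :
    TangentSpace I x →L[ℝ] TangentSpace I x :=
  if hY : MDiffAt (T% Y) x then
    have : FiniteDimensional ℝ (TangentSpace I x) := inferInstanceAs (FiniteDimensional ℝ E)
    LinearMap.toContinuousLinearMap
      { toFun u := (InnerProductSpace.toDual ℝ (TangentSpace I x)).symm (koszulForm I Y x hY u)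
        map_add' u v := by simp
        map_smul' c u := by simp }
  else 0

lemma inner_leviCivitaFun {X Y Z : Π x : M, TangentSpace I x} {x : M}
    (hX : MDiffAt (T% X) x) (hY : MDiffAt (T% Y) x) (hZ : MDiffAt (T% Z) x) :
    inner ℝ (leviCivitaFun I Y x (X x)) (Z x) = koszul I X Y Z x := by
  rw [← koszulForm_apply hX hY hZ, leviCivitaFun, dif_pos hY]
  simp

/-- Two vectors at `x` that have the same inner product with all differentiable vector fields
coincide. -/
lemma eq_of_forall_inner {x : M} {u v : TangentSpace I x}
    (h : ∀ Z : Π x : M, TangentSpace I x, MDiffAt (T% Z) x → inner ℝ u (Z x) = inner ℝ v (Z x)) :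
    u = v := by
  refine ext_inner_right ℝ fun w ↦ ?_
  have := h (FiberBundle.extend E w) (FiberBundle.mdifferentiableAt_extend ..)
  simpa using this

lemma leviCivitaFun_add {Y Y' : Π x : M, TangentSpace I x} {x : M}
    (hY : MDiffAt (T% Y) x) (hY' : MDiffAt (T% Y') x) :
    leviCivitaFun I (Y + Y') x = leviCivitaFun I Y x + leviCivitaFun I Y' x := by
  ext1 u
  refine eq_of_forall_inner fun Z hZ ↦ ?_
  set X : Π x : M, TangentSpace I x := FiberBundle.extend E u with hXdef
  have hX : MDiffAt (T% X) x := FiberBundle.mdifferentiableAt_extend ..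
  have hu : u = X x := by simp [X]
  have := FiniteDimensional.complete ℝ E
  have hYY : MDiffAt (T% (Y + Y')) x := mdifferentiableAt_add_section hY hY'
  have e1 := VectorField.mlieBracket_add_left (W := Z) hY hY'
  have e2 := VectorField.mlieBracket_add_right (V := X) hY hY'
  rw [hu, add_apply, inner_add_left, inner_leviCivitaFun hX hYY hZ,
    inner_leviCivitaFun hX hY hZ, inner_leviCivitaFun hX hY' hZ]
  simp only [koszul, metric_add_left, metric_add_right, dirDeriv_add_left,
    dirDeriv_add (metric_mdiffAt hY hZ) (metric_mdiffAt hY' hZ),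
    dirDeriv_add (metric_mdiffAt hX hY) (metric_mdiffAt hX hY')]
  simp only [metric, e1, e2, inner_add_left, Pi.add_apply]
  ring

lemma leviCivitaFun_smul {Y : Π x : M, TangentSpace I x} {φ : M → ℝ} {x : M}
    (hY : MDiffAt (T% Y) x) (hφ : MDiffAt φ x) :
    leviCivitaFun I (φ • Y) x =
      φ x • leviCivitaFun I Y x + (mvfderiv I φ x).smulRight (Y x) := by
  ext1 u
  refine eq_of_forall_inner fun Z hZ ↦ ?_
  set X : Π x : M, TangentSpace I x := FiberBundle.extend E u with hXdef
  have hX : MDiffAt (T% X) x := FiberBundle.mdifferentiableAt_extend ..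
  have hu : u = X x := by simp [X]
  have := FiniteDimensional.complete ℝ E
  have hYY : MDiffAt (T% (φ • Y)) x := hφ.smul_section hY
  have e1 := VectorField.mlieBracket_smul_left (W := Z) hφ hY
  have e2 := VectorField.mlieBracket_smul_right (V := X) hφ hY
  rw [hu, add_apply, inner_add_left, inner_leviCivitaFun hX hYY hZ,
    smul_apply, real_inner_smul_left,
    inner_leviCivitaFun hX hY hZ, ContinuousLinearMap.smulRight_apply, real_inner_smul_left]
  simp only [koszul, metric_smul_left, metric_smul_right, dirDeriv_smul_left,
    dirDeriv_mul hφ (metric_mdiffAt hY hZ), dirDeriv_mul hφ (metric_mdiffAt hX hY)]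
  simp only [metric, e1, e2, dirDeriv, inner_add_left, real_inner_smul_left, inner_neg_left,
    Pi.mul_apply, neg_smul, real_inner_comm (Y x) (X x)]
  ring

variable (I M) in
/-- The Levi-Civita connection of the Riemannian manifold `M`; the vector `∇_X Y` at `x` is
`leviCivita I M Y x (X x)`. -/
def leviCivita : CovariantDerivative I E (fun x : M ↦ TangentSpace I x) where
  toFun := leviCivitaFun I
  isCovariantDerivativeOnUniv :=
    { add := fun hY hY' _ ↦ leviCivitaFun_add hY hY'
      leibniz := fun hY hφ _ ↦ leviCivitaFun_smul hY hφ }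

variable (I M) in
/-- The Levi-Civita connection is torsion-free and compatible with the metric. -/
theorem leviCivita_spec :
    (∀ (X Y : Π x : M, TangentSpace I x) (x : M), MDiffAt (T% X) x → MDiffAt (T% Y) x →
      leviCivita I M Y x (X x) - leviCivita I M X x (Y x) = VectorField.mlieBracket I X Y x) ∧
    (∀ (X Y Z : Π x : M, TangentSpace I x) (x : M), MDiffAt (T% X) x → MDiffAt (T% Y) x →
      MDiffAt (T% Z) x →
      dirDeriv I X (metric I Y Z) x =
        inner ℝ (leviCivita I M Y x (X x)) (Z x) + inner ℝ (Y x) (leviCivita I M Z x (X x))) := by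
  have sw (X Y : Π x : M, TangentSpace I x) (x : M) :
      VectorField.mlieBracket I X Y x = - VectorField.mlieBracket I Y X x :=
    VectorField.mlieBracket_swap_apply
  constructor
  · intro X Y x hX hY
    refine eq_of_forall_inner fun Z hZ ↦ ?_
    have h1 := inner_leviCivitaFun hX hY hZ
    have h2 := inner_leviCivitaFun hY hX hZ
    rw [inner_sub_left]
    change inner ℝ (leviCivitaFun I Y x (X x)) (Z x) - inner ℝ (leviCivitaFun I X x (Y x)) (Z x) = _
    rw [h1, h2]
    simp only [koszul, metric_comm Z X, metric_comm Z Y, metric_comm Y X]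
    simp only [metric, sw Z Y, sw Y X, sw X Z, inner_neg_left]
    ring
  · intro X Y Z x hX hY hZ
    have h1 := inner_leviCivitaFun hX hY hZ
    have h2 := inner_leviCivitaFun hX hZ hY
    rw [real_inner_comm (leviCivita I M Z x (X x))]
    change _ = inner ℝ (leviCivitaFun I Y x (X x)) (Z x) + inner ℝ (leviCivitaFun I Z x (X x)) (Y x)
    rw [h1, h2]
    simp only [koszul, metric_comm Z X, metric_comm Z Y, metric_comm Y X]
    simp only [metric, sw Z Y, sw Y X, sw X Z, inner_neg_left]
    ring

variable (I) in
/-- The covariant derivative `∇_X Y`. -/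
def nabla (X Y : Π x : M, TangentSpace I x) (x : M) : TangentSpace I x :=
  leviCivita I M Y x (X x)

variable (I) in
/-- The curvature `R_{X,Y} Z = ∇_X ∇_Y Z - ∇_Y ∇_X Z - ∇_{[X,Y]} Z`. -/
def curvature (X Y Z : Π x : M, TangentSpace I x) (x : M) : TangentSpace I x :=
  nabla I X (nabla I Y Z) x - nabla I Y (nabla I X Z) x
    - nabla I (VectorField.mlieBracket I X Y) Z x

variable (I M) in
/-- `M` is flat: its curvature tensor vanishes. -/
def IsFlat : Prop :=
  ∀ X Y Z : Π x : M, TangentSpace I x, SmoothVF I X → SmoothVF I Y → SmoothVF I Z →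
    ∀ x, curvature I X Y Z x = 0

end Riemannian

/-! ### Weak almost S-structures -/

section Structures

variable {E : Type*} [NormedAddCommGroup E] [NormedSpace ℝ E]
  {H : Type*} [TopologicalSpace H] (I : ModelWithCorners ℝ E H)
  (M : Type*) [TopologicalSpace M] [ChartedSpace H M] [IsManifold I ∞ M]

/-- A framed weak `f`-structure `(f, Q, ξ_i, η^i)`, `1 ≤ i ≤ s`, on a manifold `M` (which is to have
dimension `2n + s`): smooth `(1,1)`-tensors `f` of rank `2n` and `Q` nonsingular, smooth vector
fields `ξ_i` and smooth 1-forms `η^i`. -/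
structure FramedWeakFStructure (n s : ℕ) where
  f : Π x : M, TangentSpace I x →L[ℝ] TangentSpace I x
  Q : Π x : M, TangentSpace I x →L[ℝ] TangentSpace I x
  ξ : Fin s → Π x : M, TangentSpace I x
  η : Fin s → Π x : M, TangentSpace I x →L[ℝ] ℝ
  smooth_f : ContMDiff I (I.prod 𝓘(ℝ, E →L[ℝ] E)) ∞
    (fun x ↦ TotalSpace.mk' (E →L[ℝ] E)
      (E := fun x : M ↦ TangentSpace I x →L[ℝ] TangentSpace I x) x (f x))
  smooth_Q : ContMDiff I (I.prod 𝓘(ℝ, E →L[ℝ] E)) ∞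
    (fun x ↦ TotalSpace.mk' (E →L[ℝ] E)
      (E := fun x : M ↦ TangentSpace I x →L[ℝ] TangentSpace I x) x (Q x))
  smooth_ξ : ∀ i, SmoothVF I (ξ i)
  smooth_η : ∀ i, ContMDiff I (I.prod 𝓘(ℝ, E →L[ℝ] ℝ)) ∞
    (fun x ↦ TotalSpace.mk' (E →L[ℝ] ℝ)
      (E := fun x : M ↦ TangentSpace I x →L[ℝ] Trivial M ℝ x) x (η i x))
  rank_f : ∀ x, Module.finrank ℝ (LinearMap.range (f x).toLinearMap) = 2 * n
  nonsingular_Q : ∀ x, Function.Bijective (Q x)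
  f_sq : ∀ x v, f x (f x v) = - Q x v + ∑ i, η i x v • ξ i x
  η_ξ : ∀ i j x, η i x (ξ j x) = if i = j then 1 else 0
  Q_ξ : ∀ i x, Q x (ξ i x) = ξ i x

variable {I M}

/-- The vector field `A X`, for a field `A` of endomorphisms and a vector field `X`. -/
def applyEnd (A : Π x : M, TangentSpace I x →L[ℝ] TangentSpace I x)
    (X : Π x : M, TangentSpace I x) (x : M) : TangentSpace I x := A x (X x)

/-- The exterior derivative of a 1-form, with the convention
`dα(X, Y) = (X(α(Y)) - Y(α(X)) - α([X, Y])) / 2`. -/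
def extDeriv₁ (α : Π x : M, TangentSpace I x →L[ℝ] ℝ)
    (X Y : Π x : M, TangentSpace I x) (x : M) : ℝ :=
  (dirDeriv I X (fun y ↦ α y (Y y)) x - dirDeriv I Y (fun y ↦ α y (X y)) x
    - α x (VectorField.mlieBracket I X Y x)) / 2

/-- The Lie derivative `(£_ξ A) X = [ξ, A X] - A [ξ, X]` of a field `A` of endomorphisms. -/
def lieDerivEnd (ξ : Π x : M, TangentSpace I x)
    (A : Π x : M, TangentSpace I x →L[ℝ] TangentSpace I x)
    (X : Π x : M, TangentSpace I x) (x : M) : TangentSpace I x :=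
  VectorField.mlieBracket I ξ (applyEnd A X) x - A x (VectorField.mlieBracket I ξ X x)

variable [RiemannianBundle (fun x : M ↦ TangentSpace I x)]

namespace FramedWeakFStructure

variable {n s : ℕ} (S : FramedWeakFStructure I M n s)

/-- The metric `g` of `M` is compatible with the structure, so that `(f, Q, ξ_i, η^i, g)` is a weak
metric `f`-structure: `g(f X, f Y) = g(X, Q Y) - ∑ i, η^i(X) η^i(Y)`. -/
def IsCompatible : Prop :=
  ∀ (x : M) (v w : TangentSpace I x),
    inner ℝ (S.f x v) (S.f x w) = inner ℝ v (S.Q x w) - ∑ i, S.η i x v * S.η i x w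

/-- The structure is a weak almost `S`-structure: the metric is compatible, and
`Φ = dη^1 = ... = dη^s`, where `Φ(X, Y) = g(X, f Y)`. -/
def IsWeakAlmostS : Prop :=
  S.IsCompatible ∧
    ∀ i, ∀ X Y : Π x : M, TangentSpace I x, SmoothVF I X → SmoothVF I Y →
      ∀ x, metric I X (applyEnd S.f Y) x = extDeriv₁ (S.η i) X Y x

/-- `£_{ξ_i} Q = 0` for all `i`. -/
def LieDerivQVanishes : Prop :=
  ∀ i, ∀ X : Π x : M, TangentSpace I x, SmoothVF I X → ∀ x, lieDerivEnd (S.ξ i) S.Q X x = 0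

/-- `X` is a smooth section of the contact distribution `D = ⋂ i, ker η^i`. -/
def IsContactSection (X : Π x : M, TangentSpace I x) : Prop :=
  SmoothVF I X ∧ ∀ i x, S.η i x (X x) = 0

end FramedWeakFStructure

variable [FiniteDimensional ℝ E]
  [IsContMDiffRiemannianBundle I ∞ E (fun x : M ↦ TangentSpace I x)]

/-- The covariant derivative `(∇_X A) Y = ∇_X (A Y) - A (∇_X Y)` of a field `A` of endomorphisms. -/
def nablaEnd (A : Π x : M, TangentSpace I x →L[ℝ] TangentSpace I x)
    (X Y : Π x : M, TangentSpace I x) (x : M) : TangentSpace I x :=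
  nabla I X (applyEnd A Y) x - A x (nabla I X Y x)

/-- `(∇_X Q) Y = 0` for all sections `X`, `Y` of the contact distribution `D`. -/
def FramedWeakFStructure.NablaQVanishes {n s : ℕ} (S : FramedWeakFStructure I M n s) : Prop :=
  ∀ X Y : Π x : M, TangentSpace I x, S.IsContactSection X → S.IsContactSection Y →
    ∀ x, nablaEnd S.Q X Y x = 0

end Structures

end WeakAlmostS

end

set_option linter.unusedSectionVars false

namespace WeakAlmostS

/-- The structure induced on smooth vector fields by a flat weak almost `S`-manifold with
`£_ξ Q = 0` and `∇Q = 0` along the contact distribution, after elimination of `Q`. -/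
structure FlatModel (ι : Type*) [Fintype ι] {M : Type*} (V : M → Type*)
    [∀ x, NormedAddCommGroup (V x)] [∀ x, InnerProductSpace ℝ (V x)]
    (𝔛 : Type*) [AddCommGroup 𝔛] [Module ℝ 𝔛] where
  ev : ∀ x, 𝔛 →ₗ[ℝ] V x
  ev_ext : ∀ X, (∀ x, ev x X = 0) → X = 0
  g : 𝔛 →ₗ[ℝ] 𝔛 →ₗ[ℝ] (M → ℝ)
  g_apply : ∀ X Y x, g X Y x = inner ℝ (ev x X) (ev x Y)
  nab : 𝔛 →ₗ[ℝ] Module.End ℝ 𝔛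
  f : Module.End ℝ 𝔛
  ξ : ι → 𝔛
  ev_f : ∀ x X, ev x X = 0 → ev x (f X) = 0
  ev_nab : ∀ x X Y, ev x X = 0 → ev x (nab X Y) = 0
  exists_ev : ∀ x X, ∃ (Y : 𝔛) (c : ι → ℝ), ev x X = ev x (f (f Y)) + ∑ j, c j • ev x (ξ j)
  f_ξ : ∀ i, f (ξ i) = 0
  ev_of_f_eq_zero : ∀ X, f X = 0 → ∀ x, ev x X = ∑ j, g X (ξ j) x • ev x (ξ j)
  g_f : ∀ i X Y, g X (f Y) + g X (f Y) = g (nab X (ξ i)) Y - g (nab Y (ξ i)) X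
  compat : ∀ Y Z Y' Z', g Y Z = g Y' Z' → ∀ X,
    g (nab X Y) Z + g Y (nab X Z) = g (nab X Y') Z' + g Y' (nab X Z')
  compat_ξ : ∀ i j X, g (nab X (ξ i)) (ξ j) + g (ξ i) (nab X (ξ j)) = 0
  flat : ∀ X Y Z, nab X (nab Y Z) - nab Y (nab X Z) - nab (nab X Y - nab Y X) Z = 0
  lie : ∀ i X, (∀ j, g X (ξ j) = 0) →
    f (nab (ξ i) (f (f X)) - nab (f (f X)) (ξ i) - f (f (nab (ξ i) X - nab X (ξ i)))) = 0
  par : ∀ X Y Z, (∀ j, g X (ξ j) = 0) → (∀ j, g Y (ξ j) = 0) → (∀ j, g Z (ξ j) = 0) →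
    g (nab X (f (f Y)) - f (f (nab X Y))) Z = 0

namespace FlatModel

variable {ι : Type*} [Fintype ι] {M : Type*} {V : M → Type*}
    [∀ x, NormedAddCommGroup (V x)] [∀ x, InnerProductSpace ℝ (V x)]
    {𝔛 : Type*} [AddCommGroup 𝔛] [Module ℝ 𝔛] (S : FlatModel ι V 𝔛)

lemma g_comm (X Y : 𝔛) : S.g X Y = S.g Y X := by
  ext x
  rw [S.g_apply, S.g_apply, real_inner_comm]

lemma eq_zero_of_g_self {X : 𝔛} (h : S.g X X = 0) : X = 0 :=
  S.ev_ext X fun x ↦ by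
    have := congrFun h x
    rwa [S.g_apply, Pi.zero_apply, inner_self_eq_zero] at this

lemma eq_zero_of_g {X : 𝔛} (h : ∀ Y, S.g X Y = 0) : X = 0 := S.eq_zero_of_g_self (h X)

/-- `T'` is the adjoint of `T`. -/
def IsAdj (T T' : Module.End ℝ 𝔛) : Prop := ∀ X Y, S.g (T X) Y = S.g X (T' Y)

variable {S}

namespace IsAdj

variable {T T' U U' : Module.End ℝ 𝔛}

lemma symm (h : S.IsAdj T T') : S.IsAdj T' T := fun X Y ↦ by
  rw [S.g_comm, ← h, S.g_comm]

lemma add (h : S.IsAdj T T') (h' : S.IsAdj U U') : S.IsAdj (T + U) (T' + U') := fun X Y ↦ by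
  simp [h X Y, h' X Y]

lemma sub (h : S.IsAdj T T') (h' : S.IsAdj U U') : S.IsAdj (T - U) (T' - U') := fun X Y ↦ by
  simp [h X Y, h' X Y]

lemma neg (h : S.IsAdj T T') : S.IsAdj (-T) (-T') := fun X Y ↦ by
  simp [h X Y]

lemma mul (h : S.IsAdj T T') (h' : S.IsAdj U U') : S.IsAdj (T * U) (U' * T') := fun X Y ↦ by
  rw [Module.End.mul_apply, Module.End.mul_apply, h, h']

lemma congr (h : S.IsAdj T T') (hT : T = U) (hT' : T' = U') : S.IsAdj U U' := hT ▸ hT' ▸ h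

end IsAdj

lemma IsAdj.eq_zero_of_zero {T : Module.End ℝ 𝔛} (h : S.IsAdj 0 T) : T = 0 :=
  LinearMap.ext fun Y ↦ S.eq_zero_of_g fun X ↦ by rw [S.g_comm, ← h]; simp

/-- The symmetric and the skew-symmetric part of an endomorphism are unique. -/
lemma symm_skew_zero {T U : Module.End ℝ 𝔛} (hT : S.IsAdj T T) (hU : S.IsAdj U (-U))
    (h : T + U = 0) : T = 0 ∧ U = 0 := by
  have h1 : T - U = 0 := by
    have := (hT.add hU)
    rw [h] at this
    rw [sub_eq_add_neg]
    exact this.eq_zero_of_zero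
  have h2 : T = U := sub_eq_zero.1 h1
  subst h2
  have h3 : (2 : ℝ) • T = 0 := by rw [two_smul, h]
  have h4 : T = 0 := (smul_eq_zero.1 h3).resolve_left two_ne_zero
  exact ⟨h4, h4⟩

/-- The covariant derivative of the adjoint is the adjoint of the covariant derivative. -/
lemma IsAdj.commutator {T T' : Module.End ℝ 𝔛} (h : S.IsAdj T T') (W : 𝔛) :
    S.IsAdj (S.nab W * T - T * S.nab W) (S.nab W * T' - T' * S.nab W) := fun X Y ↦ by
  have := S.compat _ _ _ _ (h X Y) W
  simp only [LinearMap.sub_apply, Module.End.mul_apply, map_sub]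
  linear_combination this - h (S.nab W X) Y - h X (S.nab W Y)

variable (S)

/-- The endomorphism `X ↦ ∇_X ξ_i`. -/
def A (i : ι) : Module.End ℝ 𝔛 := S.nab.flip (S.ξ i)

lemma A_apply (i : ι) (X : 𝔛) : S.A i X = S.nab X (S.ξ i) := rfl

/-- The symmetric part of `A i`. -/
def P (i : ι) : Module.End ℝ 𝔛 := S.A i + S.f


/-- The adjoint of `A i`. -/
def At (i : ι) : Module.End ℝ 𝔛 := S.P i + S.f

lemma A_eq (i : ι) : S.A i = S.P i - S.f := by simp [P]

lemma eq_zero_of_add_self {a : M → ℝ} (h : a + a = 0) : a = 0 := by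
  ext x
  have := congrFun h x
  simp only [Pi.add_apply, Pi.zero_apply] at this ⊢
  linarith

variable {S} in
lemma end_eq_zero_of_add_self {T : Module.End ℝ 𝔛} (h : T + T = 0) : T = 0 :=
  (smul_eq_zero.1 (two_smul ℝ T ▸ h)).resolve_left two_ne_zero

variable {S} in
lemma eq_zero_of_add_self' {X : 𝔛} (h : X + X = 0) : X = 0 :=
  (smul_eq_zero.1 (two_smul ℝ X ▸ h)).resolve_left two_ne_zero

section

variable [Nonempty ι]

lemma f_skew : S.IsAdj S.f (-S.f) := fun X Y ↦ by
  obtain ⟨i⟩ := ‹Nonempty ι›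
  have h1 := S.g_f i X Y
  have h2 := S.g_f i Y X
  have : S.g (S.f X) Y + S.g X (S.f Y) = 0 := by
    refine eq_zero_of_add_self ?_
    rw [S.g_comm (S.f X) Y]
    linear_combination h1 + h2
  simp only [LinearMap.neg_apply, map_neg]
  linear_combination this

lemma P_symm (i : ι) : S.IsAdj (S.P i) (S.P i) := fun X Y ↦ by
  have h1 := S.g_f i X Y
  have h2 := S.f_skew X Y
  simp only [P, LinearMap.add_apply, map_add, A_apply, LinearMap.neg_apply, map_neg] at *
  rw [S.g_comm X (S.nab Y _)]
  linear_combination h2 - h1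

lemma A_adj (i : ι) : S.IsAdj (S.A i) (S.At i) :=
  ((S.P_symm i).sub S.f_skew).congr (S.A_eq i).symm (sub_neg_eq_add _ _)

lemma g_f_ξ (X : 𝔛) (j : ι) : S.g (S.f X) (S.ξ j) = 0 := by
  rw [S.f_skew]; simp [S.f_ξ]

lemma g_A_ξ_comm (i j : ι) (X : 𝔛) : S.g (S.A i X) (S.ξ j) = S.g (S.A i (S.ξ j)) X := by
  have := S.g_f i X (S.ξ j)
  simp only [S.f_ξ, map_zero, ← A_apply] at this
  linear_combination -this

lemma g_A_ξ_add (i j : ι) (X : 𝔛) : S.g (S.A i X) (S.ξ j) + S.g (S.A j X) (S.ξ i) = 0 := by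
  have := S.compat_ξ i j X
  rwa [S.g_comm (S.ξ i)] at this

lemma A_ξ_add (i j : ι) : S.A i (S.ξ j) + S.A j (S.ξ i) = 0 :=
  S.eq_zero_of_g fun X ↦ by
    simp only [map_add, LinearMap.add_apply, ← g_A_ξ_comm, g_A_ξ_add]

/-- The covariant derivative of the endomorphism `T`: `(∇_W T)`. -/
def der (T : Module.End ℝ 𝔛) (W : 𝔛) : Module.End ℝ 𝔛 := S.nab W * T - T * S.nab W

lemma der_apply (T : Module.End ℝ 𝔛) (W X : 𝔛) :
    S.der T W X = S.nab W (T X) - T (S.nab W X) := rfl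

variable {S} in
lemma IsAdj.der {T T' : Module.End ℝ 𝔛} (h : S.IsAdj T T') (W : 𝔛) :
    S.IsAdj (S.der T W) (S.der T' W) := h.commutator W

lemma der_add (T U : Module.End ℝ 𝔛) (W : 𝔛) : S.der (T + U) W = S.der T W + S.der U W := by
  simp only [der]; noncomm_ring

lemma der_sub (T U : Module.End ℝ 𝔛) (W : 𝔛) : S.der (T - U) W = S.der T W - S.der U W := by
  simp only [der]; noncomm_ring

lemma der_neg (T : Module.End ℝ 𝔛) (W : 𝔛) : S.der (-T) W = -S.der T W := by
  simp only [der]; noncomm_ring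

lemma der_mul (T U : Module.End ℝ 𝔛) (W : 𝔛) :
    S.der (T * U) W = S.der T W * U + T * S.der U W := by
  simp only [der]; noncomm_ring

lemma der_A_comm (i : ι) (X Y : 𝔛) : S.der (S.A i) X Y = S.der (S.A i) Y X := by
  have := S.flat X Y (S.ξ i)
  simp only [der_apply, A_apply, map_sub, LinearMap.sub_apply] at *
  rw [← sub_eq_zero, ← this]; abel

/-- The fundamental form `g(X, f Y)` is closed. -/
lemma cyclic (X Y Z : 𝔛) :
    S.g (S.der S.f X Y) Z + S.g (S.der S.f Y Z) X + S.g (S.der S.f Z X) Y = 0 := by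
  obtain ⟨i⟩ := ‹Nonempty ι›
  have key (X Y Z : 𝔛) : S.g (S.der (S.A i) X Y) Z - S.g (S.der (S.A i) X Z) Y
      + (S.g (S.der S.f X Y) Z + S.g (S.der S.f X Y) Z) = 0 := by
    have h1 := (S.P_symm i).der X Y Z
    have h2 := S.f_skew.der X Y Z
    rw [S.g_comm Y] at h1 h2
    simp only [A_eq, der_sub, LinearMap.sub_apply, map_sub, der_neg, LinearMap.neg_apply,
      map_neg] at h1 h2 ⊢
    linear_combination h1 + h2
  refine eq_zero_of_add_self ?_
  have h1 := S.der_A_comm i X Y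
  have h2 := S.der_A_comm i Y Z
  have h3 := S.der_A_comm i Z X
  have e1 := key X Y Z
  have e2 := key Y Z X
  have e3 := key Z X Y
  rw [h1] at e1
  rw [h2] at e2
  rw [h3] at e3
  linear_combination e1 + e2 + e3

lemma f_A_ξ (i j : ι) : S.f (S.A i (S.ξ j)) = 0 := by
  refine eq_zero_of_add_self' <| S.eq_zero_of_g fun Y ↦ ?_
  have h := S.cyclic (S.ξ i) (S.ξ j) Y
  have h0 := congrArg (fun X ↦ S.g (S.f X) Y) (S.A_ξ_add i j)
  have h1 := S.f_skew.der (S.ξ j) Y (S.ξ i)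
  have h2 := S.g_f_ξ (S.nab Y (S.ξ i)) j
  have h3 := S.g_comm Y (S.f (S.A i (S.ξ j)))
  simp only [der_apply, f_ξ, map_zero, zero_sub, LinearMap.sub_apply, map_neg,
    LinearMap.neg_apply, map_sub, map_add, LinearMap.add_apply, ← A_apply, LinearMap.zero_apply,
    sub_neg_eq_add] at h h0 h1 h2 ⊢
  linear_combination h - h1 + h0 + h2 - h3

lemma A_ξ (i j : ι) : S.A i (S.ξ j) = 0 := by
  have t (i j k : ι) : S.g (S.A i (S.ξ j)) (S.ξ k) = S.g (S.A i (S.ξ k)) (S.ξ j) :=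
    S.g_A_ξ_comm i k (S.ξ j)
  have u (i j k : ι) : S.g (S.A i (S.ξ j)) (S.ξ k) + S.g (S.A j (S.ξ i)) (S.ξ k) = 0 := by
    rw [← LinearMap.add_apply, ← map_add, A_ξ_add]; simp
  have h (k : ι) : S.g (S.A i (S.ξ j)) (S.ξ k) = 0 := by
    refine eq_zero_of_add_self ?_
    linear_combination t i j k + u i k j - t k i j - u k j i + t j k i + u i j k
  refine S.ev_ext _ fun x ↦ ?_
  rw [S.ev_of_f_eq_zero _ (S.f_A_ξ i j)]
  simp [h]

lemma g_A_ξ (i j : ι) (X : 𝔛) : S.g (S.A i X) (S.ξ j) = 0 := by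
  rw [g_A_ξ_comm, A_ξ]; simp

lemma eq_zero_of_f_eq_zero {X : 𝔛} (h : S.f X = 0) (h' : ∀ j, S.g X (S.ξ j) = 0) : X = 0 :=
  S.ev_ext X fun x ↦ by rw [S.ev_of_f_eq_zero X h]; simp [h']

variable {S} in
lemma end_eq_zero_of_f_mul {T T' : Module.End ℝ 𝔛} (hT : S.IsAdj T T') (hξ : ∀ j, T' (S.ξ j) = 0)
    (h : S.f * T = 0) : T = 0 :=
  LinearMap.ext fun X ↦ S.eq_zero_of_f_eq_zero (LinearMap.congr_fun h X) fun j ↦ by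
    rw [hT, hξ]; simp

variable {S} in
lemma end_eq_zero_of_f_mul_f {T T' : Module.End ℝ 𝔛} (hT : S.IsAdj T T')
    (hξ : ∀ j, T (S.ξ j) = 0) (hξ' : ∀ j, T' (S.ξ j) = 0) (h : S.f * T * S.f = 0) : T = 0 := by
  have h1 : T * S.f = 0 :=
    end_eq_zero_of_f_mul (hT.mul S.f_skew) (by simp [hξ']) (by rw [← h, mul_assoc])
  have h2 := hT.mul S.f_skew
  rw [h1] at h2
  have h3 : S.f * T' = 0 := by simpa using h2.eq_zero_of_zero
  have h4 : T' = 0 := end_eq_zero_of_f_mul hT.symm hξ h3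
  rw [h4] at hT
  exact hT.symm.eq_zero_of_zero

lemma P_ξ (i j : ι) : S.P i (S.ξ j) = 0 := by simp [P, A_ξ, f_ξ]

lemma At_ξ (i j : ι) : S.At i (S.ξ j) = 0 := by simp [At, P_ξ, f_ξ]

lemma der_A (i j : ι) : S.der (S.A j) (S.ξ i) = -(S.A j * S.A i) := by
  ext X
  rw [der_A_comm, der_apply, A_ξ]
  simp [A_apply]

lemma der_P_der_f (i : ι) :
    S.der (S.P i) (S.ξ i) = -(S.P i * S.P i + S.f * S.f) ∧
      S.der S.f (S.ξ i) = -(S.P i * S.f + S.f * S.P i) := by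
  have hP := S.P_symm i
  have hf := S.f_skew
  have h := S.der_A i i
  rw [A_eq, der_sub] at h
  have := symm_skew_zero (S := S) (T := S.der (S.P i) (S.ξ i) + (S.P i * S.P i + S.f * S.f))
    (U := -S.der S.f (S.ξ i) - (S.P i * S.f + S.f * S.P i))
    (((hP.der _).add ((hP.mul hP).add (hf.mul hf))).congr rfl (by noncomm_ring))
    (((hf.der _).neg.sub ((hP.mul hf).add (hf.mul hP))).congr rfl (by
      rw [der_neg]; noncomm_ring))
    (by rw [← sub_eq_zero] at h; rw [← h]; noncomm_ring)
  constructor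
  · rw [← sub_eq_zero, ← this.1]; noncomm_ring
  · rw [← sub_eq_zero, ← neg_eq_zero, ← this.2]; noncomm_ring

lemma f_lie_f (i : ι) : S.f * (S.der (S.f * S.f) (S.ξ i)
    - (S.P i * S.f * S.f - S.f * S.f * S.P i)) * S.f = 0 := by
  ext X
  have := S.lie i (S.f X) (S.g_f_ξ X)
  rw [LinearMap.zero_apply, ← this]
  simp only [P, der, Module.End.mul_apply, LinearMap.sub_apply, LinearMap.add_apply, A_apply,
    map_sub, map_add]
  abel

lemma anticomm (i : ι) : S.f * S.P i + S.P i * S.f = 0 ∧ S.P i * S.P i + S.f * S.f = 0 := by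
  have hP := S.P_symm i
  have hf := S.f_skew
  obtain ⟨h1, h2⟩ := S.der_P_der_f i
  set p := S.P i with hp
  set φ := S.f with hφ
  have hLK := S.f_lie_f i
  have hff : S.IsAdj (φ * φ) (φ * φ) := (hf.mul hf).congr rfl (by noncomm_ring)
  have hL : S.IsAdj (S.der (φ * φ) (S.ξ i)) (S.der (φ * φ) (S.ξ i)) := hff.der _
  have hK : S.IsAdj (p * φ * φ - φ * φ * p) (-(p * φ * φ - φ * φ * p)) :=
    ((hP.mul hff).sub (hff.mul hP)).congr (by noncomm_ring) (by noncomm_ring)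
  have hz := symm_skew_zero (S := S) (T := φ * S.der (φ * φ) (S.ξ i) * φ)
    (U := -(φ * (p * φ * φ - φ * φ * p) * φ))
    (((hf.mul hL).mul hf).congr rfl (by noncomm_ring))
    (((hf.mul hK).mul hf).neg.congr rfl (by noncomm_ring))
    (by rw [← hLK]; noncomm_ring)
  have hL' : S.der (φ * φ) (S.ξ i) = -(p * φ * φ + φ * p * φ + (φ * p * φ + φ * φ * p)) := by
    rw [der_mul, h2]; noncomm_ring
  have hξL (j : ι) : S.der (φ * φ) (S.ξ i) (S.ξ j) = 0 := by
    rw [hL']; simp [p, φ, P_ξ, f_ξ]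
  have hξK (j : ι) : (p * φ * φ - φ * φ * p) (S.ξ j) = 0 := by simp [p, φ, P_ξ, f_ξ]
  have eL := end_eq_zero_of_f_mul_f hL hξL hξL hz.1
  have eK := end_eq_zero_of_f_mul_f hK hξK (fun j ↦ by
    rw [LinearMap.neg_apply, hξK, neg_zero]) (neg_eq_zero.1 hz.2)
  have hB : φ * p + p * φ = 0 := by
    refine end_eq_zero_of_f_mul (((hf.mul hP).add (hP.mul hf)).congr rfl rfl)
      (fun j ↦ by simp [p, φ, P_ξ, f_ξ]) (end_eq_zero_of_add_self ?_)
    rw [hL', neg_eq_zero] at eL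
    rw [← sub_eq_zero.2 (eL.trans eK.symm)]
    noncomm_ring
  refine ⟨hB, ?_⟩
  have h3 : S.der φ (S.ξ i) = 0 := by rw [h2, add_comm, hB, neg_zero]
  have h4 : S.der (φ * p + p * φ) (S.ξ i) = 0 := by rw [hB]; simp [der]
  rw [der_add, der_mul, der_mul, h3, h1] at h4
  have h5 : p * φ = -(φ * p) := by rw [← sub_eq_zero, ← hB]; noncomm_ring
  have h6 : p * p * φ = φ * p * p := by
    rw [mul_assoc, h5, mul_neg, ← mul_assoc, h5]; noncomm_ring
  refine end_eq_zero_of_f_mul (((hP.mul hP).add hff).congr rfl rfl)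
      (fun j ↦ by simp [p, φ, P_ξ, f_ξ]) (end_eq_zero_of_add_self ?_)
  rw [← neg_eq_zero, ← h4]
  have h7 : φ * (p * p + φ * φ) + φ * (p * p + φ * φ)
    = φ * p * p + φ * p * p + φ * φ * φ + φ * φ * φ := by noncomm_ring
  rw [h7]
  nth_rw 2 [← h6]
  noncomm_ring

lemma A_mul_self (i : ι) : S.A i * S.A i = 0 := by
  obtain ⟨h1, h2⟩ := S.anticomm i
  have : S.A i * S.A i = (S.P i * S.P i + S.f * S.f) - (S.f * S.P i + S.P i * S.f) := by
    rw [A_eq]; noncomm_ring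
  rw [this, h1, h2, sub_zero]

lemma A_A_A (i j : ι) : S.A i * S.A j * S.A i = 0 := by
  have h := congrArg (fun T ↦ S.der T (S.ξ j)) (S.A_mul_self i)
  simp only [der_mul, der_A] at h
  have h0 : S.der 0 (S.ξ j) = 0 := by simp [der]
  rw [h0] at h
  have h1 : S.A i * -(S.A i * S.A j) = -(S.A i * S.A i * S.A j) := by noncomm_ring
  rw [h1, A_mul_self] at h
  simpa using h

lemma A_eq_A (i j : ι) : S.A i = S.A j := by
  have hN : S.IsAdj (S.P j - S.P i) (S.P j - S.P i) := (S.P_symm j).sub (S.P_symm i)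
  have hA := S.A_adj i
  have hAj : S.A j = S.A i + (S.P j - S.P i) := by rw [A_eq, A_eq]; noncomm_ring
  have e1 := S.A_mul_self i
  have e2 := S.A_mul_self j
  have e3 := S.A_A_A i j
  have e4 : S.At i * S.At i = 0 := by
    have := hA.mul hA
    rw [e1] at this
    exact this.eq_zero_of_zero
  have hf : S.At i - S.A i = S.f + S.f := by rw [A_eq, At]; noncomm_ring
  rw [hAj] at e2 e3
  generalize hN' : S.P j - S.P i = N at *
  have e5 : S.A i * N * S.A i = 0 := by
    have : S.A i * (S.A i + N) * S.A i = S.A i * S.A i * S.A i + S.A i * N * S.A i := by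
      noncomm_ring
    rw [this, e1] at e3
    simpa using e3
  have e6 : S.A i * N + N * S.A i + N * N = 0 := by
    have : (S.A i + N) * (S.A i + N) = S.A i * S.A i + (S.A i * N + N * S.A i + N * N) := by
      noncomm_ring
    rwa [this, e1, zero_add] at e2
  have e7 : S.At i * N * S.At i = 0 := by
    have := (hA.mul hN).mul hA
    rw [e5] at this
    rw [mul_assoc]; exact this.eq_zero_of_zero
  have e8 : N * S.At i + S.At i * N + N * N = 0 := by
    have := ((hA.mul hN).add (hN.mul hA)).add (hN.mul hN)
    rw [e6] at this
    exact this.eq_zero_of_zero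
  have e9 : S.A i * (N * N) = 0 := by
    have : S.A i * (S.A i * N + N * S.A i + N * N) =
      S.A i * S.A i * N + S.A i * N * S.A i + S.A i * (N * N) := by noncomm_ring
    rw [e6, e1, e5] at this
    simpa using this.symm
  have e10 : S.At i * (N * N) = 0 := by
    have : S.At i * (N * S.At i + S.At i * N + N * N) =
      S.At i * S.At i * N + S.At i * N * S.At i + S.At i * (N * N) := by noncomm_ring
    rw [e8, e4, e7] at this
    simpa using this.symm
  have hNξ (k : ι) : N (S.ξ k) = 0 := by rw [← hN']; simp [P_ξ]
  have e11 : N * N = 0 := by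
    refine end_eq_zero_of_f_mul (hN.mul hN) (fun k ↦ by simp [hNξ]) (end_eq_zero_of_add_self ?_)
    rw [← add_mul, ← hf, sub_mul, e9, e10, sub_zero]
  have e12 : N = 0 := LinearMap.ext fun X ↦ S.eq_zero_of_g_self <| by
    rw [hN, ← Module.End.mul_apply, e11]; simp
  rw [hAj, e12, add_zero]

variable (i : ι)

lemma eq_zero_of_symm_skew {t : 𝔛 → 𝔛 → 𝔛 → (M → ℝ)} (h : ∀ X Y Z, t X Y Z = t Y X Z)
    (h' : ∀ X Y Z, t X Y Z + t X Z Y = 0) (X Y Z : 𝔛) : t X Y Z = 0 := by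
  refine eq_zero_of_add_self ?_
  linear_combination h X Y Z + h' Y X Z - h Y Z X - h' Z Y X + h Z X Y + h' X Y Z

lemma der_A_ξ (X : 𝔛) (j : ι) : S.der (S.A i) X (S.ξ j) = 0 := by
  rw [der_apply, A_ξ, ← A_apply, S.A_eq_A j i, ← Module.End.mul_apply, A_mul_self]
  simp

lemma der_A_A (X Y : 𝔛) : S.der (S.A i) X (S.A i Y) = -S.A i (S.der (S.A i) X Y) := by
  have h : S.der (S.A i * S.A i) X Y = 0 := by rw [A_mul_self]; simp [der]
  rw [der_mul] at h
  rw [← add_eq_zero_iff_eq_neg]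
  exact h

lemma A_A_apply (X : 𝔛) : S.A i (S.A i X) = 0 := by
  rw [← Module.End.mul_apply, A_mul_self]; rfl

lemma At_At_apply (X : 𝔛) : S.At i (S.At i X) = 0 :=
  S.eq_zero_of_g fun Y ↦ by rw [(S.A_adj i).symm, (S.A_adj i).symm, A_A_apply]; simp

lemma der_A_A_A (X Y : 𝔛) : S.der (S.A i) (S.A i X) (S.A i Y) = 0 := by
  rw [der_A_A, der_A_comm, der_A_A]
  simp [A_A_apply]

lemma g_At_ξ (X : 𝔛) (j : ι) : S.g (S.At i X) (S.ξ j) = 0 := by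
  rw [(S.A_adj i).symm, A_ξ]; simp

lemma A_At : S.A i * S.At i + S.At i * S.A i = (-4 : ℝ) • (S.f * S.f) := by
  have hf : S.At i - S.A i = S.f + S.f := by rw [A_eq, At]; noncomm_ring
  have h1 : (S.At i - S.A i) * (S.At i - S.A i) = (S.f + S.f) * (S.f + S.f) := by rw [hf]
  have h2 : S.At i * S.At i = 0 := LinearMap.ext fun X ↦ S.At_At_apply i X
  have h3 : (S.At i - S.A i) * (S.At i - S.A i) =
      S.At i * S.At i + S.A i * S.A i - (S.A i * S.At i + S.At i * S.A i) := by noncomm_ring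
  rw [h3, h2, A_mul_self] at h1
  have h4 : (S.f + S.f) * (S.f + S.f) = (4 : ℝ) • (S.f * S.f) := by
    rw [← two_smul ℝ, smul_mul_smul_comm]; norm_num
  rw [h4] at h1
  rw [neg_smul, ← h1]; simp

lemma g_der_A_At {X Y Z : 𝔛} (hX : ∀ j, S.g X (S.ξ j) = 0) (hY : ∀ j, S.g Y (S.ξ j) = 0)
    (hZ : ∀ j, S.g Z (S.ξ j) = 0) (hY' : S.At i Y = 0) (hZ' : S.At i Z = 0) :
    S.g (S.der (S.A i) X Z) (S.A i Y) + S.g (S.der (S.A i) X Y) (S.A i Z) = 0 := by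
  have h := S.par X Y Z hX hY hZ
  have h1 : S.der (S.A i * S.At i + S.At i * S.A i) X = (-4 : ℝ) • S.der (S.f * S.f) X := by
    rw [A_At]; simp [der, smul_sub]
  have h2 : S.g (S.der (S.A i * S.At i + S.At i * S.A i) X Y) Z = 0 := by
    rw [h1, LinearMap.smul_apply, map_smul, LinearMap.smul_apply]
    rw [der_apply]
    simp only [Module.End.mul_apply]
    rw [h, smul_zero]
  have hd := (S.A_adj i).der X
  rw [der_add, der_mul, der_mul] at h2
  simp only [LinearMap.add_apply, Module.End.mul_apply, hY', map_zero, map_add, zero_add] at h2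
  rw [S.A_adj i, hZ', hd.symm (S.A i Y), (S.A_adj i).symm] at h2
  rw [S.g_comm _ (S.A i Y)]
  simpa using h2

lemma g_der_At_At_A (X Y Z : 𝔛) :
    S.g (S.der (S.A i) (S.At i X) (S.At i Y)) (S.A i (S.At i Z)) = 0 := by
  refine eq_zero_of_symm_skew
    (t := fun X Y Z ↦ S.g (S.der (S.A i) (S.At i X) (S.At i Y)) (S.A i (S.At i Z)))
    (fun X Y Z ↦ by rw [der_A_comm]) (fun X Y Z ↦ ?_) X Y Z
  rw [add_comm]
  exact S.g_der_A_At i (S.g_At_ξ i _) (S.g_At_ξ i _) (S.g_At_ξ i _) (S.At_At_apply i _)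
    (S.At_At_apply i _)

lemma g_der_At_At_At (X Y Z : 𝔛) :
    S.g (S.der (S.A i) (S.At i X) (S.At i Y)) (S.At i (S.A i (S.At i Z))) = 0 := by
  refine eq_zero_of_symm_skew
    (t := fun X Y Z ↦ S.g (S.der (S.A i) (S.At i X) (S.At i Y)) (S.At i (S.A i (S.At i Z))))
    (fun X Y Z ↦ by rw [der_A_comm]) (fun X Y Z ↦ ?_) X Y Z
  have := S.g_der_A_At i (X := S.A i (S.At i X)) (Y := S.At i Y) (Z := S.At i Z)
    (fun j ↦ S.g_A_ξ i j _) (S.g_At_ξ i _) (S.g_At_ξ i _) (S.At_At_apply i _) (S.At_At_apply i _)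
  rw [der_A_comm, der_A_A, S.der_A_comm i _ (S.At i Y), der_A_A, map_neg, map_neg,
    LinearMap.neg_apply, LinearMap.neg_apply, S.A_adj i, S.A_adj i, S.der_A_comm i (S.At i Z),
    S.der_A_comm i (S.At i Y)] at this
  linear_combination -this

lemma f_der_A_f_f (X Y : 𝔛) : S.f (S.der (S.A i) (S.f (S.f X)) (S.f (S.f Y))) = 0 := by
  have hF (X : 𝔛) : S.f (S.f X) = (-4 : ℝ)⁻¹ • (S.A i (S.At i X) + S.At i (S.A i X)) := by
    have := LinearMap.congr_fun (S.A_At i) X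
    simp only [LinearMap.add_apply, Module.End.mul_apply, LinearMap.smul_apply] at this
    rw [this, smul_smul]; norm_num
  have hlin (a b : ℝ) (X Y : 𝔛) :
      S.der (S.A i) (a • X) (b • Y) = (a * b) • S.der (S.A i) X Y := by
    simp only [der_apply, map_smul, LinearMap.smul_apply, smul_sub, smul_smul, mul_comm]
  have hadd (X X' Y : 𝔛) :
      S.der (S.A i) (X + X') Y = S.der (S.A i) X Y + S.der (S.A i) X' Y := by
    rw [der_A_comm, map_add, der_A_comm, S.der_A_comm i Y]
  have m (X Y W : 𝔛) : S.g (S.der (S.A i) (S.At i Y) (S.A i (S.At i X)))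
      (S.A i (S.At i (S.A i (S.At i W)))) = 0 := by
    rw [der_A_A, map_neg, LinearMap.neg_apply, S.A_adj i, S.g_der_At_At_At, neg_zero]
  have m' (X Y W : 𝔛) : S.g (S.der (S.A i) (S.At i Y) (S.A i (S.At i X)))
      (S.At i (S.A i (S.At i (S.A i W)))) = 0 := by
    rw [der_A_A, map_neg, LinearMap.neg_apply, S.A_adj i, At_At_apply]; simp
  have key (W : 𝔛) : S.g (S.der (S.A i) (S.f (S.f X)) (S.f (S.f Y)))
      (S.f (S.f (S.f (S.f W)))) = 0 := by
    rw [hF X, hF Y, hlin, hadd, map_add, map_add, der_A_A_A, hF W]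
    simp only [map_smul, LinearMap.smul_apply, map_add, LinearMap.add_apply, hF, A_A_apply,
      At_At_apply, map_zero, add_zero, zero_add]
    rw [S.der_A_comm i (S.A i (S.At i X)) (S.At i (S.A i Y)), m, m', m, m', g_der_At_At_A,
      g_der_At_At_At]
    simp
  generalize S.der (S.A i) (S.f (S.f X)) (S.f (S.f Y)) = C at key ⊢
  have hfs (X Y : 𝔛) : S.g X (S.f Y) = - S.g (S.f X) Y := by rw [S.f_skew]; simp
  have h4 : S.f (S.f (S.f (S.f C))) = 0 := S.eq_zero_of_g fun W ↦ by
    have := key W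
    rw [hfs, hfs, hfs, hfs] at this
    simpa using this
  exact S.eq_zero_of_f_eq_zero (S.eq_zero_of_f_eq_zero (S.eq_zero_of_f_eq_zero h4
    (S.g_f_ξ _)) (S.g_f_ξ _)) (S.g_f_ξ _)

/-- A field of endomorphisms that vanishes on the `ξ_j` and on the image of `f²` is zero. -/
lemma end_eq_zero_of_f_f {T : Module.End ℝ 𝔛} (hT : ∀ x X, S.ev x X = 0 → S.ev x (T X) = 0)
    (hf : ∀ X, T (S.f (S.f X)) = 0) (hξ : ∀ j, T (S.ξ j) = 0) : T = 0 :=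
  LinearMap.ext fun X ↦ S.ev_ext _ fun x ↦ by
    obtain ⟨Y, c, h⟩ := S.exists_ev x X
    have := hT x (X - (S.f (S.f Y) + ∑ j, c j • S.ξ j)) (by simp [h])
    simpa [hf, hξ] using this

lemma ev_der_A (Y : 𝔛) (x : M) (X : 𝔛) (h : S.ev x X = 0) : S.ev x (S.der (S.A i) Y X) = 0 := by
  rw [der_A_comm, der_apply, map_sub, S.ev_nab x X _ h, A_apply,
    S.ev_nab x _ _ (S.ev_nab x X _ h), sub_zero]

lemma f_der_A (X Y : 𝔛) : S.f (S.der (S.A i) X Y) = 0 := by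
  have hp (Y : 𝔛) : ∀ x X, S.ev x X = 0 → S.ev x ((S.f * S.der (S.A i) Y) X) = 0 :=
    fun x X h ↦ S.ev_f x _ (S.ev_der_A i Y x X h)
  have hξ (Y : 𝔛) (j : ι) : (S.f * S.der (S.A i) Y) (S.ξ j) = 0 := by
    rw [Module.End.mul_apply, der_A_ξ, map_zero]
  have h1 (Y : 𝔛) : S.f * S.der (S.A i) (S.f (S.f Y)) = 0 :=
    S.end_eq_zero_of_f_f (hp _) (fun X ↦ S.f_der_A_f_f i Y X) (hξ _)
  have h2 : S.f * S.der (S.A i) X = 0 := S.end_eq_zero_of_f_f (hp _) (fun Y ↦ by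
    rw [Module.End.mul_apply, der_A_comm]; exact LinearMap.congr_fun (h1 Y) X) (hξ _)
  exact LinearMap.congr_fun h2 Y

lemma g_der_A_ξ (X Y : 𝔛) (j : ι) :
    S.g (S.der (S.A i) X Y) (S.ξ j) = -S.g (S.A i X) (S.A i Y) := by
  have h := S.compat (S.A i Y) (S.ξ j) 0 0 (by rw [g_A_ξ]; simp) X
  rw [← A_apply, S.A_eq_A j i] at h
  rw [der_apply, map_sub, LinearMap.sub_apply, g_A_ξ, S.g_comm (S.A i X)]
  simp only [map_zero, add_zero, sub_zero] at h ⊢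
  linear_combination h

lemma g_der_A (X Y Z : 𝔛) :
    S.g (S.der (S.A i) X Y) Z = -S.g (S.A i X) (S.A i Y) * ∑ j, S.g (S.ξ j) Z := by
  ext x
  rw [S.g_apply, S.ev_of_f_eq_zero _ (S.f_der_A i X Y) x]
  simp only [g_der_A_ξ, sum_inner, real_inner_smul_left, ← S.g_apply, Pi.mul_apply,
    Finset.sum_apply, Finset.mul_sum]

lemma g_der_A_A (X Y Z : 𝔛) : S.g (S.der (S.A i) X Y) (S.A i Z) = 0 := by
  rw [g_der_A, Finset.sum_eq_zero, mul_zero]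
  intro j _
  rw [g_comm, g_A_ξ]

lemma g_der_A_der_A (X Y Z W : 𝔛) : S.g (S.der (S.A i) X Y) (S.der (S.A i) Z W) =
    Fintype.card ι * (S.g (S.A i X) (S.A i Y) * S.g (S.A i Z) (S.A i W)) := by
  rw [g_der_A]
  simp only [S.g_comm (S.ξ _), g_der_A_ξ, Finset.sum_const, Finset.card_univ, nsmul_eq_mul]
  ring

/-- The Ricci identity for the covariant derivative of `A`. -/
lemma ricci (X Y Z W : 𝔛) : S.g (S.der (S.A i) X Y) (S.der (S.A i) Z W) =
    S.g (S.der (S.A i) Z Y) (S.der (S.A i) X W) := by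
  have key (X Y Z W : 𝔛) : S.g (S.der (S.A i) X Y) (S.der (S.A i) Z W) =
      -S.g (S.nab Z (S.der (S.A i) X Y)) (S.A i W) := by
    have h := S.compat _ _ 0 0 ((S.g_der_A_A i X Y W).trans (by simp)) Z
    rw [S.der_apply _ Z, map_sub, g_der_A_A]
    simp only [map_zero, add_zero, sub_zero] at h ⊢
    linear_combination h
  have h1 := S.flat Z X (S.A i Y)
  have h2 := S.flat Z X Y
  have h3 : S.nab Z (S.der (S.A i) X Y) - S.nab X (S.der (S.A i) Z Y) =
      S.der (S.A i) (S.nab Z X - S.nab X Z) Y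
        + S.der (S.A i) X (S.nab Z Y) - S.der (S.A i) Z (S.nab X Y) := by
    have h2' := congrArg (S.A i) h2
    simp only [der_apply, map_sub, map_zero, LinearMap.sub_apply] at h1 h2' ⊢
    rw [← sub_eq_zero, ← sub_eq_zero.2 (h1.trans h2'.symm)]
    abel
  have h4 := congrArg (fun U ↦ S.g U (S.A i W)) h3
  simp only [map_sub, map_add, LinearMap.sub_apply, LinearMap.add_apply, g_der_A_A] at h4
  rw [key, key Z Y X W]
  linear_combination -h4

theorem g_A_mul_g_A (X Z : 𝔛) (x : M) :
    S.g (S.A i X) (S.A i X) x * S.g (S.A i Z) (S.A i Z) x = S.g (S.A i X) (S.A i Z) x ^ 2 := by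
  have h := S.ricci i X X Z Z
  rw [g_der_A_der_A, g_der_A_der_A] at h
  have hx := congrFun h x
  simp only [Pi.mul_apply, Pi.natCast_apply] at hx
  have h0 : (Fintype.card ι : ℝ) ≠ 0 := by simp
  rw [mul_left_cancel₀ h0 hx, S.g_comm (S.A i Z) (S.A i X), sq]

end

end FlatModel

noncomputable section

section

variable {E : Type*} [NormedAddCommGroup E] [NormedSpace ℝ E]
  {H : Type*} [TopologicalSpace H] {I : ModelWithCorners ℝ E H}
  {M : Type*} [TopologicalSpace M] [ChartedSpace H M] [IsManifold I ∞ M]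

lemma contMDiffAt_dirDeriv {X : Π x : M, TangentSpace I x} {φ : M → ℝ} {x : M}
    (hX : CMDiffAt ∞ (T% X) x) (hφ : CMDiffAt ∞ φ x) : CMDiffAt ∞ (dirDeriv I X φ) x := by
  have h1 := hφ.mfderiv_const (m := ∞) le_rfl
  have h2 := ContMDiffAt.clm_apply_of_inCoordinates (n := ∞) (b₁ := id) (b₂ := φ)
    (E₁ := fun x : M ↦ TangentSpace I x) (E₂ := fun y : ℝ ↦ TangentSpace 𝓘(ℝ, ℝ) y)
    (ϕ := fun x ↦ mfderiv I 𝓘(ℝ, ℝ) φ x) (F₁ := E) (F₂ := ℝ) h1 hX hφ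
  rw [contMDiffAt_totalSpace] at h2
  have h3 := h2.2
  simp at h3
  exact h3

/-- Every tangent vector is the value of a smooth vector field. -/
lemma exists_smoothVF [FiniteDimensional ℝ E] [T2Space M] [SigmaCompactSpace M] (x : M)
    (v : TangentSpace I x) : ∃ X : Π x : M, TangentSpace I x, SmoothVF I X ∧ X x = v := by
  obtain ⟨s, hs⟩ := exists_contMDiffSection_forall_mem_convex_of_local (n := ⊤) I
    (F_fiber := E) (fun x : M ↦ TangentSpace I x) (fun y ↦ {w | ∀ h : y = x, w = h ▸ v})
    (fun y u hu w hw a b _ _ hab h ↦ by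
      rw [hu h, hw h, ← add_smul, hab, one_smul])
    (fun y ↦ by
      by_cases hy : y = x
      · subst hy
        obtain ⟨s, hs, h⟩ := FiberBundle.exists_contMDiffOn_extend (k := ∞) I E v
        exact ⟨s, hs, _, h, fun z _ hz ↦ by subst hz; simp⟩
      · refine ⟨{x}ᶜ, isOpen_compl_singleton.mem_nhds hy, fun _ ↦ 0, ?_, fun z hz h ↦ (hz h).elim⟩
        exact (contMDiff_zeroSection ℝ (fun x : M ↦ TangentSpace I x)).contMDiffOn)
  exact ⟨s, s.contMDiff, hs x rfl⟩

variable [RiemannianBundle (fun x : M ↦ TangentSpace I x)]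
  [IsContMDiffRiemannianBundle I ∞ E (fun x : M ↦ TangentSpace I x)]

lemma contMDiffAt_metric {X Y : Π x : M, TangentSpace I x} {x : M}
    (hX : CMDiffAt ∞ (T% X) x) (hY : CMDiffAt ∞ (T% Y) x) : CMDiffAt ∞ (metric I X Y) x :=
  ContMDiffAt.inner_bundle (E := fun x : M ↦ TangentSpace I x) (F := E) (b := id) hX hY

lemma contMDiffAt_det {n : Type*} [Fintype n] [DecidableEq n] {A : M → Matrix n n ℝ} {x : M}
    (h : ∀ i j, CMDiffAt ∞ (fun y ↦ A y i j) x) : CMDiffAt ∞ (fun y ↦ (A y).det) x := by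
  simp only [Matrix.det_apply']
  refine ContMDiffAt.sum fun σ _ ↦ contMDiffAt_const.mul ?_
  exact contMDiffAt_finsetProd fun i _ ↦ h _ _

variable [FiniteDimensional ℝ E]

lemma contMDiffAt_mlieBracket {X Y : Π x : M, TangentSpace I x} {x : M}
    (hX : CMDiffAt ∞ (T% X) x) (hY : CMDiffAt ∞ (T% Y) x) :
    CMDiffAt ∞ (T% (VectorField.mlieBracket I X Y)) x := by
  have := FiniteDimensional.complete ℝ E
  have : IsManifold I ((⊤ : ℕ∞) + 1) M := inferInstanceAs (IsManifold I ∞ M)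
  have : IsManifold I (minSmoothness ℝ 2) M := by
    rw [minSmoothness_of_isRCLikeNormedField]; infer_instance
  exact ContMDiffAt.mlieBracket_vectorField (m := ⊤) (n := ⊤) hX hY (by simp)

lemma contMDiffAt_koszul {X Y Z : Π x : M, TangentSpace I x} {x : M}
    (hX : CMDiffAt ∞ (T% X) x) (hY : CMDiffAt ∞ (T% Y) x) (hZ : CMDiffAt ∞ (T% Z) x) :
    CMDiffAt ∞ (koszul I X Y Z) x := by
  have e1 := contMDiffAt_dirDeriv hX (contMDiffAt_metric hY hZ)
  have e2 := contMDiffAt_dirDeriv hY (contMDiffAt_metric hZ hX)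
  have e3 := contMDiffAt_dirDeriv hZ (contMDiffAt_metric hX hY)
  have e4 := contMDiffAt_metric (contMDiffAt_mlieBracket hX hY) hZ
  have e5 := contMDiffAt_metric (contMDiffAt_mlieBracket hY hZ) hX
  have e6 := contMDiffAt_metric (contMDiffAt_mlieBracket hZ hX) hY
  exact (((((e1.add e2).sub e3).add e4).sub e5).add e6).div_const 2

/-- A vector field is smooth if its inner products with local smooth vector fields are. -/
lemma contMDiffAt_of_metric {U : Π x : M, TangentSpace I x} {x : M}
    (h : ∀ Z : Π x : M, TangentSpace I x, (∀ᶠ y in nhds x, CMDiffAt ∞ (T% Z) y) →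
      CMDiffAt ∞ (metric I U Z) x) : CMDiffAt ∞ (T% U) x := by
  let e := trivializationAt E (fun x : M ↦ TangentSpace I x) x
  let b := Module.finBasis ℝ E
  have hx : x ∈ e.baseSet := FiberBundle.mem_baseSet_trivializationAt' x
  have hs := e.isLocalFrameOn_localFrame_baseSet I ∞ b
  have hnhds : e.baseSet ∈ nhds x := e.open_baseSet.mem_nhds hx
  set Z := e.localFrame b with hZdef
  have hZ (i) : ∀ᶠ y in nhds x, CMDiffAt ∞ (T% (Z i)) y := by
    filter_upwards [hnhds] with y hy using hs.contMDiffAt e.open_baseSet hy i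
  let G (y : M) : Matrix _ _ ℝ := Matrix.gram ℝ (fun i ↦ Z i y)
  have hG (i j) : CMDiffAt ∞ (fun y ↦ G y i j) x :=
    contMDiffAt_metric (hZ i).self_of_nhds (hZ j).self_of_nhds
  have hU (i) : CMDiffAt ∞ (metric I U (Z i)) x := h _ (hZ i)
  have hdet (y) (hy : y ∈ e.baseSet) : (G y).det ≠ 0 :=
    (Matrix.det_gram_ne_zero_iff_linearIndependent).2 (hs.linearIndependent hy)
  refine hs.contMDiffAt_of_coeff (fun i ↦ ?_) hnhds
  have hc : CMDiffAt ∞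
      (fun y ↦ (G y).cramer (fun j ↦ metric I U (Z j) y) i / (G y).det) x := by
    refine ContMDiffAt.div₀ ?_ (contMDiffAt_det hG) (hdet x hx)
    simp only [Matrix.cramer_apply]
    refine contMDiffAt_det fun j k ↦ ?_
    by_cases hk : k = i
    · simpa [Matrix.updateCol_apply, hk] using hU j
    · simpa [Matrix.updateCol_apply, hk] using hG j k
  refine hc.congr_of_eventuallyEq ?_
  filter_upwards [hnhds] with y hy
  have h1 : (G y).mulVec (fun i ↦ hs.coeff i y (U y)) = fun j ↦ metric I U (Z j) y := by
    ext j
    have h0 := congrArg (fun u : TangentSpace I y ↦ (inner ℝ u (Z j y) : ℝ))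
      (hs.coeff_sum_eq U hy)
    rw [metric, h0, sum_inner]
    change ∑ i, G y j i * hs.coeff i y (U y) = _
    refine Finset.sum_congr rfl fun i _ ↦ ?_
    rw [real_inner_smul_left, real_inner_comm, mul_comm]
    rfl
  rw [← h1, Matrix.cramer_eq_adjugate_mulVec, Matrix.mulVec_mulVec, Matrix.adjugate_mul,
    Matrix.smul_mulVec, Matrix.one_mulVec, Pi.smul_apply, smul_eq_mul,
    mul_div_cancel_left₀ _ (hdet y hy)]
  rfl

lemma SmoothVF.mdiffAt {X : Π x : M, TangentSpace I x} (hX : SmoothVF I X) (x : M) :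
    MDiffAt (T% X) x := (hX x).mdifferentiableAt (by simp)

lemma SmoothVF.nabla {X Y : Π x : M, TangentSpace I x} (hX : SmoothVF I X) (hY : SmoothVF I Y) :
    SmoothVF I (nabla I X Y) := fun x ↦ by
  refine contMDiffAt_of_metric fun Z hZ ↦ ?_
  refine (contMDiffAt_koszul (hX x) (hY x) hZ.self_of_nhds).congr_of_eventuallyEq ?_
  filter_upwards [hZ] with y hy
  exact inner_leviCivitaFun (hX.mdiffAt y) (hY.mdiffAt y) (hy.mdifferentiableAt (by simp))

end

/-- If the image of `a` is at most a line, the skew-symmetric part of `a` has rank at most two. -/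
lemma finrank_range_le_two {V : Type*} [NormedAddCommGroup V] [InnerProductSpace ℝ V]
    [FiniteDimensional ℝ V] (a f : V →ₗ[ℝ] V)
    (h : ∀ v w, inner ℝ v (f w) + inner ℝ v (f w) = inner ℝ (a v) w - inner ℝ (a w) v)
    (ha : ∀ v w, inner ℝ (a v) (a v) * inner ℝ (a w) (a w) = (inner ℝ (a v) (a w) : ℝ) ^ 2) :
    Module.finrank ℝ (LinearMap.range f) ≤ 2 := by
  by_cases h0 : a = 0
  · have : f = 0 := LinearMap.ext fun w ↦ ext_inner_left ℝ fun v ↦ by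
      have := h v w
      simp only [h0, LinearMap.zero_apply, inner_zero_left, inner_zero_right] at this ⊢
      linarith
    rw [this, LinearMap.range_zero, finrank_bot]
    exact Nat.zero_le _
  obtain ⟨v₀, hv₀⟩ : ∃ v, a v ≠ 0 := by
    by_contra! hc
    exact h0 (LinearMap.ext hc)
  set u := a v₀ with hu
  have huu : (inner ℝ u u : ℝ) ≠ 0 := inner_self_ne_zero.2 hv₀
  have hw (w) : (inner ℝ u u : ℝ) • a w = (inner ℝ u (a w) : ℝ) • u := by
    rw [← sub_eq_zero, ← inner_self_eq_zero (𝕜 := ℝ)]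
    simp only [inner_sub_left, inner_sub_right, real_inner_smul_left, real_inner_smul_right,
      real_inner_comm u (a w)]
    linear_combination inner ℝ u u * ha v₀ w
  set u' := LinearMap.adjoint a u with hu'
  have hf (w) : (2 * inner ℝ u u : ℝ) • f w =
      (inner ℝ u w : ℝ) • u' - (inner ℝ u (a w) : ℝ) • u := by
    refine ext_inner_left ℝ fun v ↦ ?_
    have h1 := congrArg (fun z ↦ (inner ℝ z w : ℝ)) (hw v)
    have h2 := congrArg (fun z ↦ (inner ℝ z v : ℝ)) (hw w)
    have h3 : (inner ℝ v u' : ℝ) = inner ℝ u (a v) := by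
      rw [hu', LinearMap.adjoint_inner_right, real_inner_comm]
    simp only [real_inner_smul_left, real_inner_smul_right, inner_sub_right, h3] at h1 h2 ⊢
    rw [real_inner_comm u v]
    linear_combination inner ℝ u u * h v w + h1 - h2
  classical
  have hle : LinearMap.range f ≤ Submodule.span ℝ (({u', u} : Finset V) : Set V) := by
    rintro _ ⟨w, rfl⟩
    have : f w = (2 * inner ℝ u u : ℝ)⁻¹ •
        ((inner ℝ u w : ℝ) • u' - (inner ℝ u (a w) : ℝ) • u) := by
      rw [← hf, inv_smul_smul₀ (mul_ne_zero two_ne_zero huu)]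
    rw [this]
    refine Submodule.smul_mem _ _ (Submodule.sub_mem _ (Submodule.smul_mem _ _ ?_)
      (Submodule.smul_mem _ _ ?_)) <;> exact Submodule.subset_span (by simp)
  exact (Submodule.finrank_mono hle).trans
    ((finrank_span_finset_le_card _).trans Finset.card_le_two)

section

variable {E : Type*} [NormedAddCommGroup E] [NormedSpace ℝ E] [FiniteDimensional ℝ E]
  {H : Type*} [TopologicalSpace H] {I : ModelWithCorners ℝ E H}
  {M : Type*} [TopologicalSpace M] [ChartedSpace H M] [IsManifold I ∞ M]

namespace FramedWeakFStructure

variable {n s : ℕ} (S : FramedWeakFStructure I M n s)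

lemma eq_sum_of_f_eq_zero {x : M} {v : TangentSpace I x} (h : S.f x v = 0) :
    v = ∑ i, S.η i x v • S.ξ i x := by
  refine (S.nonsingular_Q x).1 ?_
  have := S.f_sq x v
  rw [h, map_zero] at this
  rw [eq_comm, neg_add_eq_zero] at this
  simpa only [map_sum, map_smul, S.Q_ξ] using this

lemma f_ξ (hE : Module.finrank ℝ E = 2 * n + s) (i : Fin s) (x : M) : S.f x (S.ξ i x) = 0 := by
  have : FiniteDimensional ℝ (TangentSpace I x) := inferInstanceAs (FiniteDimensional ℝ E)
  let K := LinearMap.ker (S.f x).toLinearMap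
  let U := Submodule.span ℝ (Set.range fun i ↦ S.ξ i x)
  have hK : Module.finrank ℝ K = s := by
    have h1 : Module.finrank ℝ (LinearMap.range (S.f x).toLinearMap) + Module.finrank ℝ K =
        Module.finrank ℝ (TangentSpace I x) := LinearMap.finrank_range_add_finrank_ker _
    rw [S.rank_f x, show Module.finrank ℝ (TangentSpace I x) = 2 * n + s from hE] at h1
    omega
  have hKU : K ≤ U := fun v hv ↦ by
    rw [S.eq_sum_of_f_eq_zero (x := x) (v := v) hv]
    exact Submodule.sum_mem _ fun j _ ↦ Submodule.smul_mem _ _ (Submodule.subset_span ⟨j, rfl⟩)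
  have hU : Module.finrank ℝ U ≤ s := (finrank_range_le_card _).trans (by simp)
  have : K = U := Submodule.eq_of_le_of_finrank_le hKU (hU.trans hK.ge)
  have hi : S.ξ i x ∈ K := this ▸ Submodule.subset_span ⟨i, rfl⟩
  exact hi

lemma exists_eq_f_f_add {x : M} (v : TangentSpace I x) :
    ∃ (w : TangentSpace I x) (c : Fin s → ℝ), v = S.f x (S.f x w) + ∑ j, c j • S.ξ j x := by
  obtain ⟨w, hw⟩ := (S.nonsingular_Q x).2 (-v)
  refine ⟨w, fun j ↦ -S.η j x w, ?_⟩
  rw [S.f_sq, hw]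
  simp

variable [RiemannianBundle (fun x : M ↦ TangentSpace I x)]

lemma inner_ξ (hS : S.IsCompatible) (hE : Module.finrank ℝ E = 2 * n + s) (i : Fin s) (x : M)
    (v : TangentSpace I x) : inner ℝ v (S.ξ i x) = S.η i x v := by
  have := hS x v (S.ξ i x)
  rw [S.f_ξ hE, inner_zero_right, S.Q_ξ] at this
  simp only [S.η_ξ] at this
  simp at this
  linarith

end FramedWeakFStructure

variable (I M) in
/-- The space of smooth vector fields. -/
def smoothVF : Submodule ℝ (Π x : M, TangentSpace I x) where
  carrier := {X | SmoothVF I X}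
  add_mem' h h' := ContMDiff.add_section h h'
  zero_mem' := contMDiff_zeroSection ℝ (fun x : M ↦ TangentSpace I x)
  smul_mem' _ _ h := ContMDiff.const_smul_section h

lemma SmoothVF.applyEnd {A : Π x : M, TangentSpace I x →L[ℝ] TangentSpace I x}
    (hA : ContMDiff I (I.prod 𝓘(ℝ, E →L[ℝ] E)) ∞ (fun x ↦ TotalSpace.mk' (E →L[ℝ] E)
      (E := fun x : M ↦ TangentSpace I x →L[ℝ] TangentSpace I x) x (A x)))
    {X : Π x : M, TangentSpace I x} (hX : SmoothVF I X) : SmoothVF I (applyEnd A X) :=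
  ContMDiff.clm_bundle_apply (E₁ := fun x : M ↦ TangentSpace I x)
    (E₂ := fun x : M ↦ TangentSpace I x) hA hX

variable [RiemannianBundle (fun x : M ↦ TangentSpace I x)]
  [IsContMDiffRiemannianBundle I ∞ E (fun x : M ↦ TangentSpace I x)]

/-- The covariant derivative of smooth vector fields, as a bilinear map. -/
def nablaSmooth : smoothVF I M →ₗ[ℝ] Module.End ℝ (smoothVF I M) :=
  LinearMap.mk₂ ℝ (fun X Y ↦ ⟨nabla I X.1 Y.1, SmoothVF.nabla X.2 Y.2⟩)
    (fun X X' Y ↦ Subtype.ext <| funext fun x ↦ by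
      change leviCivita I M Y.1 x (X.1 x + X'.1 x) = _
      rw [map_add]; rfl)
    (fun c X Y ↦ Subtype.ext <| funext fun x ↦ by
      change leviCivita I M Y.1 x (c • X.1 x) = _
      rw [map_smul]; rfl)
    (fun X Y Y' ↦ Subtype.ext <| funext fun x ↦ by
      change leviCivitaFun I (Y.1 + Y'.1) x (X.1 x) = _
      rw [leviCivitaFun_add (SmoothVF.mdiffAt Y.2 x) (SmoothVF.mdiffAt Y'.2 x)]; rfl)
    (fun c X Y ↦ Subtype.ext <| funext fun x ↦ by
      have := leviCivitaFun_smul (φ := fun _ ↦ c) (SmoothVF.mdiffAt Y.2 x) mdifferentiableAt_const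
      change leviCivitaFun I ((fun _ : M ↦ c) • Y.1) x (X.1 x) = _
      rw [this]
      simp [mvfderiv_const]
      rfl)

/-- The metric on smooth vector fields, as a bilinear map. -/
def metricSmooth : smoothVF I M →ₗ[ℝ] smoothVF I M →ₗ[ℝ] (M → ℝ) :=
  LinearMap.mk₂ ℝ (fun X Y ↦ metric I X.1 Y.1)
    (fun _ _ _ ↦ metric_add_left _ _ _)
    (fun _ _ _ ↦ funext fun _ ↦ real_inner_smul_left _ _ _)
    (fun _ _ _ ↦ metric_add_right _ _ _)
    (fun _ _ _ ↦ funext fun _ ↦ real_inner_smul_right _ _ _)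

/-- A field of endomorphisms as a linear map on smooth vector fields. -/
def endSmooth (A : Π x : M, TangentSpace I x →L[ℝ] TangentSpace I x)
    (hA : ContMDiff I (I.prod 𝓘(ℝ, E →L[ℝ] E)) ∞ (fun x ↦ TotalSpace.mk' (E →L[ℝ] E)
      (E := fun x : M ↦ TangentSpace I x →L[ℝ] TangentSpace I x) x (A x))) :
    Module.End ℝ (smoothVF I M) where
  toFun X := ⟨applyEnd A X.1, SmoothVF.applyEnd hA X.2⟩
  map_add' _ _ := Subtype.ext <| funext fun x ↦ map_add (A x) _ _
  map_smul' c _ := Subtype.ext <| funext fun x ↦ map_smul (A x) c _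

end

section

variable {E : Type*} [NormedAddCommGroup E] [NormedSpace ℝ E] [FiniteDimensional ℝ E]
  {H : Type*} [TopologicalSpace H] {I : ModelWithCorners ℝ E H}
  {M : Type*} [TopologicalSpace M] [ChartedSpace H M] [IsManifold I ∞ M]
  [RiemannianBundle (fun x : M ↦ TangentSpace I x)]
  [IsContMDiffRiemannianBundle I ∞ E (fun x : M ↦ TangentSpace I x)]

lemma SmoothVF.mlieBracket_eq {X Y : Π x : M, TangentSpace I x} (hX : SmoothVF I X)
    (hY : SmoothVF I Y) (x : M) :
    VectorField.mlieBracket I X Y x = WeakAlmostS.nabla I X Y x - WeakAlmostS.nabla I Y X x :=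
  ((leviCivita_spec I M).1 X Y x (hX.mdiffAt x) (hY.mdiffAt x)).symm

lemma SmoothVF.dirDeriv_metric {X Y Z : Π x : M, TangentSpace I x} (hX : SmoothVF I X)
    (hY : SmoothVF I Y) (hZ : SmoothVF I Z) :
    dirDeriv I X (metric I Y Z) =
      metric I (WeakAlmostS.nabla I X Y) Z + metric I Y (WeakAlmostS.nabla I X Z) :=
  funext fun x ↦ (leviCivita_spec I M).2 X Y Z x (hX.mdiffAt x) (hY.mdiffAt x) (hZ.mdiffAt x)

namespace FramedWeakFStructure

variable {n s : ℕ} (S : FramedWeakFStructure I M n s)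

lemma f_f_eq_neg {X : Π x : M, TangentSpace I x} (h : ∀ j x, S.η j x (X x) = 0) :
    applyEnd S.f (applyEnd S.f X) = -applyEnd S.Q X := by
  ext x
  simp [applyEnd, S.f_sq, h]

lemma f_sub_f_f (hE : Module.finrank ℝ E = 2 * n + s) {x : M} {u v : TangentSpace I x}
    (h : u = -S.Q x v) : S.f x (u - S.f x (S.f x v)) = 0 := by
  rw [h, S.f_sq]
  simp [S.f_ξ hE]

/-- The algebraic model of a flat weak almost `S`-manifold. -/
def flatModel [T2Space M] [SigmaCompactSpace M] (hE : Module.finrank ℝ E = 2 * n + s)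
    (hS : S.IsWeakAlmostS) (hLie : S.LieDerivQVanishes) (hNabla : S.NablaQVanishes)
    (hflat : IsFlat I M) :
    FlatModel (Fin s) (fun x : M ↦ TangentSpace I x) (smoothVF I M) where
  ev x := LinearMap.proj x ∘ₗ (smoothVF I M).subtype
  ev_ext X h := Subtype.ext (funext h)
  g := metricSmooth
  g_apply X Y x := rfl
  nab := nablaSmooth
  f := endSmooth S.f S.smooth_f
  ξ i := ⟨S.ξ i, S.smooth_ξ i⟩
  ev_f x X h := by
    change S.f x (X.1 x) = 0
    rw [show X.1 x = 0 from h, map_zero]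
  ev_nab x X Y h := by
    change leviCivita I M Y.1 x (X.1 x) = 0
    rw [show X.1 x = 0 from h, map_zero]
  exists_ev x X := by
    obtain ⟨w, c, h⟩ := S.exists_eq_f_f_add (X.1 x)
    obtain ⟨Y, hY, rfl⟩ := exists_smoothVF x w
    exact ⟨⟨Y, hY⟩, c, h⟩
  f_ξ i := Subtype.ext <| funext fun x ↦ S.f_ξ hE i x
  ev_of_f_eq_zero X h x := by
    have h1 : S.f x (X.1 x) = 0 := congrFun (congrArg Subtype.val h) x
    change X.1 x = ∑ j, (inner ℝ (X.1 x) (S.ξ j x) : ℝ) • S.ξ j x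
    simp only [S.inner_ξ hS.1 hE]
    exact S.eq_sum_of_f_eq_zero h1
  g_f i X Y := by
    have hη (Z : Π x : M, TangentSpace I x) :
        (fun y ↦ S.η i y (Z y)) = metric I Z (S.ξ i) :=
      funext fun y ↦ (S.inner_ξ hS.1 hE i y _).symm
    have h := hS.2 i X.1 Y.1 X.2 Y.2
    ext x
    have hx := h x
    rw [extDeriv₁, hη, hη, SmoothVF.mlieBracket_eq X.2 Y.2, ← S.inner_ξ hS.1 hE, inner_sub_left,
      SmoothVF.dirDeriv_metric X.2 Y.2 (S.smooth_ξ i),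
      SmoothVF.dirDeriv_metric Y.2 X.2 (S.smooth_ξ i)] at hx
    change metric I X.1 (applyEnd S.f Y.1) x + metric I X.1 (applyEnd S.f Y.1) x =
      metric I (nabla I X.1 (S.ξ i)) Y.1 x - metric I (nabla I Y.1 (S.ξ i)) X.1 x
    rw [hx, metric_comm _ Y.1, metric_comm _ X.1]
    simp only [Pi.add_apply, metric]
    ring
  compat Y Z Y' Z' h X := by
    have h1 := SmoothVF.dirDeriv_metric X.2 Y.2 Z.2
    have h2 := SmoothVF.dirDeriv_metric X.2 Y'.2 Z'.2
    rw [show metric I Y.1 Z.1 = metric I Y'.1 Z'.1 from h, h2] at h1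
    exact h1.symm
  compat_ξ i j X := by
    have h1 := SmoothVF.dirDeriv_metric X.2 (S.smooth_ξ i) (S.smooth_ξ j)
    have h2 : metric I (S.ξ i) (S.ξ j) = fun _ ↦ if j = i then 1 else 0 :=
      funext fun x ↦ by rw [metric, S.inner_ξ hS.1 hE, S.η_ξ]
    refine h1.symm.trans (funext fun x ↦ ?_)
    rw [h2]
    simp [dirDeriv, mvfderiv_const]
  flat X Y Z := Subtype.ext <| funext fun x ↦ by
    have h := hflat X.1 Y.1 Z.1 X.2 Y.2 Z.2 x
    rw [curvature] at h
    refine Eq.trans ?_ h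
    change _ - _ - leviCivita I M Z.1 x _ = _ - _ - leviCivita I M Z.1 x _
    rw [SmoothVF.mlieBracket_eq X.2 Y.2]
    rfl
  lie i X h := Subtype.ext <| funext fun x ↦ by
    have hX (j x) : S.η j x (X.1 x) = 0 := by
      rw [← S.inner_ξ hS.1 hE]; exact congrFun (h j) x
    let ξ : smoothVF I M := ⟨S.ξ i, S.smooth_ξ i⟩
    let W : smoothVF I M := endSmooth S.f S.smooth_f (endSmooth S.f S.smooth_f X)
    have hW : applyEnd S.Q X.1 = (-W).1 := neg_eq_iff_eq_neg.1 (S.f_f_eq_neg hX).symm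
    have h1 := hLie i X.1 X.2 x
    rw [lieDerivEnd, hW, SmoothVF.mlieBracket_eq (S.smooth_ξ i) X.2,
      SmoothVF.mlieBracket_eq (S.smooth_ξ i) (-W).2] at h1
    have e1 : nabla I (S.ξ i) (-W).1 x = -nabla I (S.ξ i) W.1 x :=
      congrFun (congrArg Subtype.val (map_neg (nablaSmooth ξ) W)) x
    have e2 : nabla I (-W).1 (S.ξ i) x = -nabla I W.1 (S.ξ i) x :=
      map_neg (leviCivita I M (S.ξ i) x) (W.1 x)
    rw [e1, e2] at h1
    refine S.f_sub_f_f hE (u := nabla I (S.ξ i) W.1 x - nabla I W.1 (S.ξ i) x)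
      (v := nabla I (S.ξ i) X.1 x - nabla I X.1 (S.ξ i) x) ?_
    rw [← sub_eq_zero.1 h1]
    abel
  par X Y Z hX hY hZ := by
    have hη {X : smoothVF I M} (h : ∀ j, metricSmooth X ⟨S.ξ j, S.smooth_ξ j⟩ = 0) (j x) :
        S.η j x (X.1 x) = 0 := by
      rw [← S.inner_ξ hS.1 hE]; exact congrFun (h j) x
    let W : smoothVF I M := endSmooth S.f S.smooth_f (endSmooth S.f S.smooth_f Y)
    have hW : applyEnd S.Q Y.1 = (-W).1 := neg_eq_iff_eq_neg.1 (S.f_f_eq_neg (hη hY)).symm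
    ext x
    have h1 := hNabla X.1 Y.1 ⟨X.2, hη hX⟩ ⟨Y.2, hη hY⟩ x
    have e1 : nabla I X.1 (-W).1 x = -nabla I X.1 W.1 x :=
      congrFun (congrArg Subtype.val (map_neg (nablaSmooth X) W)) x
    rw [nablaEnd, hW, e1, sub_eq_zero] at h1
    change inner ℝ (nabla I X.1 W.1 x - S.f x (S.f x (nabla I X.1 Y.1 x))) (Z.1 x) = (0 : ℝ)
    rw [S.f_sq, ← h1]
    simp only [neg_neg, sub_add_cancel_left, real_inner_comm (Z.1 x), inner_neg_right, inner_sum,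
      real_inner_smul_right, S.inner_ξ hS.1 hE, hη hZ, mul_zero, Finset.sum_const_zero, neg_zero]

end FramedWeakFStructure

/-- A flat weak almost `S`-manifold satisfying the two conditions on `Q` has `n ≤ 1`. -/
theorem FramedWeakFStructure.le_one [T2Space M] [SigmaCompactSpace M] [Nonempty M] {n s : ℕ}
    (S : FramedWeakFStructure I M n s) (hs : 0 < s) (hE : Module.finrank ℝ E = 2 * n + s)
    (hS : S.IsWeakAlmostS) (hLie : S.LieDerivQVanishes) (hNabla : S.NablaQVanishes)
    (hflat : IsFlat I M) : n ≤ 1 := by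
  let i : Fin s := ⟨0, hs⟩
  have : Nonempty (Fin s) := ⟨i⟩
  obtain ⟨x⟩ := ‹Nonempty M›
  have : FiniteDimensional ℝ (TangentSpace I x) := inferInstanceAs (FiniteDimensional ℝ E)
  let F := S.flatModel hE hS hLie hNabla hflat
  have h := finrank_range_le_two (leviCivita I M (S.ξ i) x).toLinearMap (S.f x).toLinearMap
    (fun v w ↦ by
      obtain ⟨X, hX, rfl⟩ := exists_smoothVF x v
      obtain ⟨Y, hY, rfl⟩ := exists_smoothVF x w
      exact congrFun (F.g_f i ⟨X, hX⟩ ⟨Y, hY⟩) x)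
    (fun v w ↦ by
      obtain ⟨X, hX, rfl⟩ := exists_smoothVF x v
      obtain ⟨Y, hY, rfl⟩ := exists_smoothVF x w
      exact F.g_A_mul_g_A i ⟨X, hX⟩ ⟨Y, hY⟩ x)
  rw [S.rank_f x] at h
  omega

end

end

end WeakAlmostS

theorem mainTheorem4 (n s : ℕ) (hs : 0 < s)
    (M : Type*) [TopologicalSpace M] [T2Space M] [SecondCountableTopology M] [Nonempty M]
    [ChartedSpace (EuclideanSpace ℝ (Fin (2 * n + s))) M] [IsManifold (𝓡 (2 * n + s)) ∞ M]
    [RiemannianBundle (fun x : M ↦ TangentSpace (𝓡 (2 * n + s)) x)]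
    [IsContMDiffRiemannianBundle (𝓡 (2 * n + s)) ∞ (EuclideanSpace ℝ (Fin (2 * n + s)))
      (fun x : M ↦ TangentSpace (𝓡 (2 * n + s)) x)]
    (S : WeakAlmostS.FramedWeakFStructure (𝓡 (2 * n + s)) M n s)
    (hS : S.IsWeakAlmostS)
    (hLie : S.LieDerivQVanishes)
    (hNabla : S.NablaQVanishes)
    (hflat : WeakAlmostS.IsFlat (𝓡 (2 * n + s)) M) :
    n ≤ 1 := by
  have : LocallyCompactSpace M :=
    Manifold.locallyCompact_of_finiteDimensional (M := M) (𝓡 (2 * n + s))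
  exact S.le_one hs (by simp) hS hLie hNabla hflat
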